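/- **Universal uniqueness of the connecting homomorphism.** Compositions are written from left to right: $\alpha\cdot\beta$ means first $\alpha$, then $\beta$. Let $Q$ be the quiver $a \xrightarrow{\alpha} b \xrightarrow{\beta} c \xrightarrow{\gamma} d$ and let $R$ be the single relation $\alpha\cdot\beta\cdot\gamma=0$. Let $\mathcal{C}(Q,R)$ be the $\mathbb{Z}$-linear category whose objects are the vertices of $Q$ and whose morphisms are $\mathbb{Z}$-linear combinations of paths modulo the two-sided ideal generated by $R$, and let $\mathcal{C}(Q,R)^{\oplus}$ be its additive closure (finite, possibly empty, tuples of objects, with matrices as morphisms). For an additive category $\mathbf{A}$, the Adelman category $\mathrm{Adel}(\mathbf{A})$ is the following abelian category. Its objects are the composable pairs $(r_x \xrightarrow{\rho_x} x \xrightarrow{\gamma_x} c_x)$ in $\mathbf{A}$ (with no condition on $\rho_x\cdot\gamma_x$). A morphism from $(r_x \to x \to c_x)$ to $(r_y \to y \to c_y)$ is a class $\{\varphi\}$ of a morphism $\varphi: x\to y$ for which there exist $\omega: r_x\to r_y$ and $\psi: c_x\to c_y$ with $\omega\cdot\rho_y=\rho_x\cdot\varphi$ and $\gamma_x\cdot\psi=\varphi\cdot\gamma_y$;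 here $\{\varphi\}=\{\varphi'\}$ if and only if $\varphi-\varphi'=\sigma_1\cdot\rho_y+\gamma_x\cdot\sigma_2$ for some $\sigma_1: x\to r_y$ and $\sigma_2: c_x\to y$. Composition and addition are induced from $\mathbf{A}$. In $\mathrm{Adel}(\mathcal{C}(Q,R)^{\oplus})$ put $$K=(a \xrightarrow{\alpha} b \xrightarrow{\beta\cdot\gamma} d),\qquad C=(a \xrightarrow{\alpha\cdot\beta} c \xrightarrow{\gamma} d).$$ Then: 1. The abelian group $\mathrm{Hom}(K, C)$ is isomorphic to $\mathbb{Z}$, with generator $\{\beta\}$. 2. For a morphism $\partial: K\to C$, the (snake) sequence $$(0\to a \xrightarrow{\alpha\cdot\beta} c) \xrightarrow{\{\alpha\}} (0\to b\xrightarrow{\beta} c)\xrightarrow{\{\mathrm{id}_b\}} K \xrightarrow{\ \partial\ } C \xrightarrow{\{\mathrm{id}_c\}} (b\xrightarrow{\beta} c\to 0)\xrightarrow{\{\gamma\}} (b\xrightarrow{\beta\cdot\gamma} d\to 0)$$ is exact (at its four inner terms) if and only if $\partial=\{\beta\}$ or $\partial=-\{\beta\}$. -/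

import Mathlib

open CategoryTheory CategoryTheory.Limits

universe v u

/-! ## The category `C(Q, R)` of a quiver with relations -/

section QuiverWithRelations

variable {Q : Type u} [Quiver.{v} Q]

/-- The two-sided ideal generated by a family `R` of `ℤ`-linear combinations of paths
(`R f` says that `f` is one of the given relations), in degree `(X, Y)`: the subgroup of `X ⟶ Y`
generated by all composites `p ≫ r ≫ q` with `R r`. -/
noncomputable def pathIdeal (R : MorphismProperty (Free ℤ (Paths Q))) (X Y : Free ℤ (Paths Q)) :
    AddSubgroup (X ⟶ Y) :=
  AddSubgroup.closure {f | ∃ (U V : Free ℤ (Paths Q)) (p : X ⟶ U) (r : U ⟶ V) (q : V ⟶ Y),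
    R r ∧ f = p ≫ r ≫ q}

theorem pathIdeal_comp_left (R : MorphismProperty (Free ℤ (Paths Q)))
    {X Y Z : Free ℤ (Paths Q)} (f : X ⟶ Y) {g : Y ⟶ Z} (hg : g ∈ pathIdeal R Y Z) :
    f ≫ g ∈ pathIdeal R X Z := by
  refine AddSubgroup.closure_induction
    (p := fun g _ => f ≫ g ∈ pathIdeal R X Z) ?_ ?_ ?_ ?_ hg
  · rintro _ ⟨U, V, p, r, q, hr, rfl⟩
    exact AddSubgroup.subset_closure ⟨U, V, f ≫ p, r, q, hr, by simp only [Category.assoc]⟩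
  · rw [comp_zero]
    exact zero_mem _
  · intro a b _ _ ha hb
    rw [Preadditive.comp_add]
    exact add_mem ha hb
  · intro a _ ha
    rw [Preadditive.comp_neg]
    exact neg_mem ha

theorem pathIdeal_comp_right (R : MorphismProperty (Free ℤ (Paths Q)))
    {X Y Z : Free ℤ (Paths Q)} {f : X ⟶ Y} (g : Y ⟶ Z) (hf : f ∈ pathIdeal R X Y) :
    f ≫ g ∈ pathIdeal R X Z := by
  refine AddSubgroup.closure_induction
    (p := fun f _ => f ≫ g ∈ pathIdeal R X Z) ?_ ?_ ?_ ?_ hf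
  · rintro _ ⟨U, V, p, r, q, hr, rfl⟩
    exact AddSubgroup.subset_closure ⟨U, V, p, r, q ≫ g, hr, by simp only [Category.assoc]⟩
  · rw [zero_comp]
    exact zero_mem _
  · intro a b _ _ ha hb
    rw [Preadditive.add_comp]
    exact add_mem ha hb
  · intro a _ ha
    rw [Preadditive.neg_comp]
    exact neg_mem ha

/-- Congruence modulo the ideal generated by `R`. -/
def pathRel (R : MorphismProperty (Free ℤ (Paths Q))) : HomRel (Free ℤ (Paths Q)) :=
  fun X Y f g => f - g ∈ pathIdeal R X Y

instance pathRel_congruence (R : MorphismProperty (Free ℤ (Paths Q))) :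
    Congruence (pathRel R) where
  equivalence {X Y} :=
    { refl := fun f => by
        change f - f ∈ pathIdeal R X Y
        rw [sub_self]
        exact zero_mem _
      symm := fun {f g} h => by
        change g - f ∈ pathIdeal R X Y
        rw [← neg_sub]
        exact neg_mem h
      trans := fun {f g k} h h' => by
        change f - k ∈ pathIdeal R X Y
        rw [← sub_add_sub_cancel f g k]
        exact add_mem h h' }
  comp_left f g g' h := by
    change f ≫ g - f ≫ g' ∈ _
    rw [← Preadditive.comp_sub]
    exact pathIdeal_comp_left R f h
  comp_right g h := by
    change _ ≫ g - _ ≫ g ∈ _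
    rw [← Preadditive.sub_comp]
    exact pathIdeal_comp_right R g h

/-- The `ℤ`-linear category `C(Q, R)`: objects are the vertices of `Q`, morphisms are `ℤ`-linear
combinations of paths modulo the relations `R`. -/
abbrev QuiverCat (R : MorphismProperty (Free ℤ (Paths Q))) : Type u :=
  CategoryTheory.Quotient (pathRel R)

noncomputable instance QuiverCat.preadditive (R : MorphismProperty (Free ℤ (Paths Q))) :
    Preadditive (QuiverCat R) :=
  CategoryTheory.Quotient.preadditive (pathRel R) (by
    intro X Y f₁ f₂ g₁ g₂ hf hg
    change (f₁ + g₁) - (f₂ + g₂) ∈ pathIdeal R X Y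
    rw [add_sub_add_comm]
    exact add_mem hf hg)

/-- The class in `C(Q, R)` of a path of `Q`. -/
noncomputable def QuiverCat.ofPaths (R : MorphismProperty (Free ℤ (Paths Q))) :
    Paths Q ⥤ QuiverCat R :=
  Free.embedding ℤ (Paths Q) ⋙ CategoryTheory.Quotient.functor (pathRel R)

end QuiverWithRelations

/-! ## The Adelman category -/

/-- Objects of the Adelman category of `A`: composable pairs `rel ⟶ mid ⟶ corel`
(the composite is not required to vanish). -/
structure Adel (A : Type u) [Category.{v} A] where
  {rel : A}
  {mid : A}
  {corel : A}
  ρ : rel ⟶ mid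
  γ : mid ⟶ corel

namespace Adel

variable {A : Type u} [Category.{v} A] [Preadditive A]

/-- The morphism data: morphisms `α` between the middle objects that admit a relation witness `ω`
and a corelation witness `ψ`. -/
def datum (X Y : Adel A) : AddSubgroup (X.mid ⟶ Y.mid) where
  carrier := {α | (∃ ω : X.rel ⟶ Y.rel, ω ≫ Y.ρ = X.ρ ≫ α) ∧
    (∃ ψ : X.corel ⟶ Y.corel, X.γ ≫ ψ = α ≫ Y.γ)}
  zero_mem' := ⟨⟨0, by simp⟩, ⟨0, by simp⟩⟩
  add_mem' := by
    rintro α β ⟨⟨ω, h⟩, ⟨ψ, k⟩⟩ ⟨⟨ω', h'⟩, ⟨ψ', k'⟩⟩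
    exact ⟨⟨ω + ω', by simp [h, h']⟩, ⟨ψ + ψ', by simp [k, k']⟩⟩
  neg_mem' := by
    rintro α ⟨⟨ω, h⟩, ⟨ψ, k⟩⟩
    exact ⟨⟨-ω, by simp [h]⟩, ⟨-ψ, by simp [k]⟩⟩

/-- The morphisms `σ₁ ≫ ρ + γ ≫ σ₂`; two morphism data are identified if they differ by one
of these. -/
def null (X Y : Adel A) : AddSubgroup (X.mid ⟶ Y.mid) where
  carrier := {α | ∃ (σ₁ : X.mid ⟶ Y.rel) (σ₂ : X.corel ⟶ Y.mid), α = σ₁ ≫ Y.ρ + X.γ ≫ σ₂}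
  zero_mem' := ⟨0, 0, by simp⟩
  add_mem' := by
    rintro _ _ ⟨σ₁, σ₂, rfl⟩ ⟨τ₁, τ₂, rfl⟩
    exact ⟨σ₁ + τ₁, σ₂ + τ₂, by
      rw [Preadditive.add_comp, Preadditive.comp_add]; exact add_add_add_comm _ _ _ _⟩
  neg_mem' := by
    rintro _ ⟨σ₁, σ₂, rfl⟩
    exact ⟨-σ₁, -σ₂, by rw [Preadditive.neg_comp, Preadditive.comp_neg]; exact neg_add _ _⟩

/-- Morphisms in the Adelman category: morphism data modulo `null`. -/
abbrev Hom (X Y : Adel A) : Type v :=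
  datum X Y ⧸ (null X Y).addSubgroupOf (datum X Y)

theorem id_mem_datum (X : Adel A) : 𝟙 X.mid ∈ datum X X :=
  ⟨⟨𝟙 _, by simp⟩, ⟨𝟙 _, by simp⟩⟩

theorem comp_mem_datum {X Y Z : Adel A} {α : X.mid ⟶ Y.mid} {β : Y.mid ⟶ Z.mid}
    (hα : α ∈ datum X Y) (hβ : β ∈ datum Y Z) : α ≫ β ∈ datum X Z := by
  obtain ⟨⟨ω, h⟩, ⟨ψ, k⟩⟩ := hα
  obtain ⟨⟨ω', h'⟩, ⟨ψ', k'⟩⟩ := hβ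
  exact ⟨⟨ω ≫ ω', by rw [Category.assoc, h', reassoc_of% h]⟩,
    ⟨ψ ≫ ψ', by rw [reassoc_of% k, k', Category.assoc]⟩⟩

theorem null_comp_mem {X Y Z : Adel A} {α : X.mid ⟶ Y.mid} {β : Y.mid ⟶ Z.mid}
    (hα : α ∈ null X Y) (hβ : β ∈ datum Y Z) : α ≫ β ∈ null X Z := by
  obtain ⟨σ₁, σ₂, rfl⟩ := hα
  obtain ⟨⟨ω, h⟩, -⟩ := hβ
  exact ⟨σ₁ ≫ ω, σ₂ ≫ β, by simp [h]⟩

theorem comp_null_mem {X Y Z : Adel A} {α : X.mid ⟶ Y.mid} {β : Y.mid ⟶ Z.mid}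
    (hα : α ∈ datum X Y) (hβ : β ∈ null Y Z) : α ≫ β ∈ null X Z := by
  obtain ⟨σ₁, σ₂, rfl⟩ := hβ
  obtain ⟨-, ⟨ψ, k⟩⟩ := hα
  exact ⟨α ≫ σ₁, ψ ≫ σ₂, by simp [reassoc_of% k]⟩

/-- Composition of morphisms, induced by composition of morphism data. -/
def comp {X Y Z : Adel A} (f : Hom X Y) (g : Hom Y Z) : Hom X Z :=
  Quotient.map₂ (fun (α : datum X Y) (β : datum Y Z) =>
      (⟨α.1 ≫ β.1, comp_mem_datum α.2 β.2⟩ : datum X Z))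
    (by
      intro α α' hα β β' hβ
      rw [← Quotient.eq_iff_equiv] at hα hβ
      replace hα := QuotientAddGroup.eq.1 hα
      replace hβ := QuotientAddGroup.eq.1 hβ
      rw [AddSubgroup.mem_addSubgroupOf] at hα hβ
      refine QuotientAddGroup.leftRel_apply.2 (AddSubgroup.mem_addSubgroupOf.2 ?_)
      have h := add_mem (null_comp_mem hα β.2) (comp_null_mem α'.2 hβ)
      convert h using 1
      simp only [AddSubgroup.coe_add, AddSubgroup.coe_neg, Preadditive.add_comp,
        Preadditive.comp_add, Preadditive.neg_comp, Preadditive.comp_neg]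
      abel) f g

instance category : Category.{v} (Adel A) where
  Hom := Hom
  id X := QuotientAddGroup.mk ⟨𝟙 X.mid, id_mem_datum X⟩
  comp := comp
  id_comp := by
    rintro X Y ⟨α⟩
    exact congrArg (QuotientAddGroup.mk) (Subtype.ext (Category.id_comp α.1))
  comp_id := by
    rintro X Y ⟨α⟩
    exact congrArg (QuotientAddGroup.mk) (Subtype.ext (Category.comp_id α.1))
  assoc := by
    rintro W X Y Z ⟨α⟩ ⟨β⟩ ⟨δ⟩
    exact congrArg (QuotientAddGroup.mk) (Subtype.ext (Category.assoc α.1 β.1 δ.1))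

instance preadditive : Preadditive (Adel A) where
  homGroup X Y := inferInstanceAs (AddCommGroup (Hom X Y))
  add_comp := by
    rintro X Y Z ⟨α⟩ ⟨α'⟩ ⟨β⟩
    exact congrArg (QuotientAddGroup.mk) (Subtype.ext (Preadditive.add_comp _ _ _ α.1 α'.1 β.1))
  comp_add := by
    rintro X Y Z ⟨α⟩ ⟨β⟩ ⟨β'⟩
    exact congrArg (QuotientAddGroup.mk) (Subtype.ext (Preadditive.comp_add _ _ _ α.1 β.1 β'.1))

/-- The morphism `{α}` with morphism datum `α`. -/
def homMk {X Y : Adel A} (α : X.mid ⟶ Y.mid)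
    (hω : ∃ ω : X.rel ⟶ Y.rel, ω ≫ Y.ρ = X.ρ ≫ α)
    (hψ : ∃ ψ : X.corel ⟶ Y.corel, X.γ ≫ ψ = α ≫ Y.γ) : X ⟶ Y :=
  (QuotientAddGroup.mk (⟨α, hω, hψ⟩ : datum X Y) : Hom X Y)

end Adel

/-! ## The snake quiver and its universal snake sequence -/

/-- Vertices of the quiver `a ⟶ b ⟶ c ⟶ d`. -/
inductive SnakeVertex : Type
  | a | b | c | d

/-- Arrows of the quiver `a ⟶ b ⟶ c ⟶ d`. -/
inductive SnakeArrow : SnakeVertex → SnakeVertex → Type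
  | α : SnakeArrow .a .b
  | β : SnakeArrow .b .c
  | γ : SnakeArrow .c .d

instance SnakeVertex.quiver : Quiver SnakeVertex where
  Hom := SnakeArrow

namespace Snake

/-- The path of length one given by an arrow. -/
def arrow {x y : SnakeVertex} (f : SnakeArrow x y) :
    (Paths.of SnakeVertex).obj x ⟶ (Paths.of SnakeVertex).obj y :=
  (Paths.of SnakeVertex).map f

/-- The single relation `α ≫ β ≫ γ = 0`. -/
inductive relation : MorphismProperty (Free ℤ (Paths SnakeVertex))
  | mk : relation ((Free.embedding ℤ (Paths SnakeVertex)).map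
      (arrow .α ≫ arrow .β ≫ arrow .γ))

/-- The additive closure `C(Q, R)^⊕` for the snake quiver with its relation. -/
abbrev Cat : Type 1 := Mat_ (QuiverCat relation)

/-- A vertex of the quiver as an object of `C(Q, R)^⊕`. -/
noncomputable abbrev obj (x : SnakeVertex) : Cat :=
  (Mat_.embedding (QuiverCat relation)).obj
    ((QuiverCat.ofPaths relation).obj ((Paths.of SnakeVertex).obj x))

/-- An arrow of the quiver as a morphism of `C(Q, R)^⊕`. -/
noncomputable abbrev map {x y : SnakeVertex} (f : SnakeArrow x y) : obj x ⟶ obj y :=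
  (Mat_.embedding (QuiverCat relation)).map ((QuiverCat.ofPaths relation).map (arrow f))

noncomputable abbrev α : obj .a ⟶ obj .b := map .α
noncomputable abbrev β : obj .b ⟶ obj .c := map .β
noncomputable abbrev γ : obj .c ⟶ obj .d := map .γ

open scoped ZeroObject

/-- `(0 ⟶ a ⟶ c)` with corelation morphism `αβ`. -/
noncomputable def kerδ : Adel Cat := ⟨(0 : (0 : Cat) ⟶ obj .a), α ≫ β⟩
/-- `(0 ⟶ b ⟶ c)` with corelation morphism `β`. -/
noncomputable def kerβ : Adel Cat := ⟨(0 : (0 : Cat) ⟶ obj .b), β⟩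
/-- `(a ⟶ b ⟶ d)` with relation morphism `α` and corelation morphism `βγ`. -/
noncomputable def kerε : Adel Cat := ⟨α, β ≫ γ⟩
/-- `(a ⟶ c ⟶ d)` with relation morphism `αβ` and corelation morphism `γ`. -/
noncomputable def cokerδ : Adel Cat := ⟨α ≫ β, γ⟩
/-- `(b ⟶ c ⟶ 0)` with relation morphism `β`. -/
noncomputable def cokerβ : Adel Cat := ⟨β, (0 : obj .c ⟶ (0 : Cat))⟩
/-- `(b ⟶ d ⟶ 0)` with relation morphism `βγ`. -/
noncomputable def cokerε : Adel Cat := ⟨β ≫ γ, (0 : obj .d ⟶ (0 : Cat))⟩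

/-- `{α}` -/
noncomputable def f₁ : kerδ ⟶ kerβ :=
  Adel.homMk (X := kerδ) (Y := kerβ) α ⟨0, zero_comp.trans zero_comp.symm⟩
    ⟨𝟙 _, Category.comp_id (α ≫ β)⟩
/-- `{id_b}` -/
noncomputable def f₂ : kerβ ⟶ kerε :=
  Adel.homMk (X := kerβ) (Y := kerε) (𝟙 (obj .b)) ⟨0, zero_comp.trans zero_comp.symm⟩
    ⟨γ, (Category.id_comp (β ≫ γ)).symm⟩
/-- `{β}` -/
noncomputable def connecting : kerε ⟶ cokerδ :=
  Adel.homMk (X := kerε) (Y := cokerδ) β ⟨𝟙 _, Category.id_comp (α ≫ β)⟩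
    ⟨𝟙 _, Category.comp_id (β ≫ γ)⟩
/-- `{id_c}` -/
noncomputable def f₄ : cokerδ ⟶ cokerβ :=
  Adel.homMk (X := cokerδ) (Y := cokerβ) (𝟙 (obj .c)) ⟨α, (Category.comp_id (α ≫ β)).symm⟩
    ⟨0, comp_zero.trans comp_zero.symm⟩
/-- `{γ}` -/
noncomputable def f₅ : cokerβ ⟶ cokerε :=
  Adel.homMk (X := cokerβ) (Y := cokerε) γ ⟨𝟙 _, Category.id_comp (β ≫ γ)⟩
    ⟨0, comp_zero.trans comp_zero.symm⟩

/-- The snake sequence with a given morphism `∂` in the middle. -/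
noncomputable def sequence (bd : kerε ⟶ cokerδ) : ComposableArrows (Adel Cat) 5 :=
  ComposableArrows.mk₅ f₁ f₂ bd f₄ f₅

end Snake

/-! A morphism `K ⟶ C` is represented by some `b ⟶ c`, hence by a multiple `n • β`, as `β` is the
only path from `b` to `c`. A null representative is built from `b ⟶ a` and `d ⟶ c`, which vanish, so
`n` is well defined; the representation `α ↦ 0`, `β, γ ↦ 1` shows that `n • β = 0` forces `n = 0`.

A pair `{φ}`, `{χ}` with zero composite is exact iff the kernel of `{χ}` followed by the cokernel of
`{φ}` is zero. Kernels and cokernels in the Adelman category are explicit, so this vanishing is a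
matrix identity in `A`; its entries form an `ExactWitness`, and `ExactWitness.exact` deduces
exactness from them. For the snake sequence the entries can be written down as soon as `n * n = 1`.

Conversely, exactness at `K` alone makes `n` a unit (`isUnit_of_exact`): a test object over `K`
killed by `n • {β}` must also be killed by `{β}`, which makes `β` a right multiple of `n • β`. -/

namespace CategoryTheory.ShortComplex

variable {C : Type u} [Category.{v} C] [HasZeroMorphisms C]

/-- A short complex is exact as soon as its first map induces an epimorphism to a kernel of the
second one, and its second map a monomorphism from a cokernel of the first one. -/
theorem exact_of_epi_of_mono (S : ShortComplex C) {O : C} (hO : IsZero O)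
    {K : C} (i : K ⟶ S.X₂) (wi : i ≫ S.g = 0) (hi : IsLimit (KernelFork.ofι i wi))
    (l : S.X₁ ⟶ K) (hl : l ≫ i = S.f) (_ : Epi l)
    {P : C} (p : S.X₂ ⟶ P) (wp : S.f ≫ p = 0) (hp : IsColimit (CokernelCofork.ofπ p wp))
    (m : P ⟶ S.X₃) (hm : p ≫ m = S.g) (_ : Mono m) : S.Exact := by
  have el : hi.lift (KernelFork.ofι _ S.zero) = l :=
    Fork.IsLimit.hom_ext hi ((Fork.IsLimit.lift_ι hi).trans hl.symm)
  have em : hp.desc (CokernelCofork.ofπ _ S.zero) = m :=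
    Cofork.IsColimit.hom_ext hp ((Cofork.IsColimit.π_desc hp).trans hm.symm)
  let h₁ : S.LeftHomologyData :=
    { K := K, H := O, i := i, π := 0, wi := wi, hi := hi, wπ := comp_zero
      hπ := CokernelCofork.IsColimit.ofEpiOfIsZero _ (by rwa [el]) hO }
  let h₂ : S.RightHomologyData :=
    { Q := P, H := O, p := p, ι := 0, wp := wp, hp := hp, wι := zero_comp
      hι := KernelFork.IsLimit.ofMonoOfIsZero _ (by rwa [em]) hO }
  refine ⟨⟨{ left := h₁, right := h₂, iso := Iso.refl O, comm := ?_ }, hO⟩⟩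
  change (0 : K ⟶ O) ≫ 𝟙 O ≫ (0 : O ⟶ P) = i ≫ p
  -- The left and right homology data agree once `i ≫ p = 0`; the epimorphism `l` reduces this to
  -- `S.f ≫ p = 0`.
  rw [zero_comp, ← cancel_epi l, comp_zero, reassoc_of% hl, wp]

end CategoryTheory.ShortComplex

/-! ### Representatives, kernels and cokernels in the Adelman category. -/

namespace Adel

variable {A : Type u} [Category.{v} A] [Preadditive A]

theorem exists_homMk {X Y : Adel A} (f : X ⟶ Y) : ∃ (α : X.mid ⟶ Y.mid)
    (hω : ∃ ω : X.rel ⟶ Y.rel, ω ≫ Y.ρ = X.ρ ≫ α)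
    (hψ : ∃ ψ : X.corel ⟶ Y.corel, X.γ ≫ ψ = α ≫ Y.γ), f = homMk α hω hψ := by
  obtain ⟨α, hω, hψ⟩ := f
  exact ⟨α, hω, hψ, rfl⟩

theorem homMk_eq_zero_iff {X Y : Adel A} {α : X.mid ⟶ Y.mid} (hω hψ) :
    (homMk α hω hψ : X ⟶ Y) = 0 ↔
      ∃ (σ₁ : X.mid ⟶ Y.rel) (σ₂ : X.corel ⟶ Y.mid), α = σ₁ ≫ Y.ρ + X.γ ≫ σ₂ :=
  (QuotientAddGroup.eq_zero_iff _).trans AddSubgroup.mem_addSubgroupOf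

theorem homMk_comp_homMk_eq_zero_iff {X Y Z : Adel A} {α : X.mid ⟶ Y.mid} {β : Y.mid ⟶ Z.mid}
    (hα : α ∈ datum X Y) (hβ : β ∈ datum Y Z) :
    homMk α hα.1 hα.2 ≫ homMk β hβ.1 hβ.2 = 0 ↔
      ∃ (σ₁ : X.mid ⟶ Z.rel) (σ₂ : X.corel ⟶ Z.mid), α ≫ β = σ₁ ≫ Z.ρ + X.γ ≫ σ₂ :=
  homMk_eq_zero_iff (comp_mem_datum hα hβ).1 (comp_mem_datum hα hβ).2

theorem homMk_congr {X Y : Adel A} {α β : X.mid ⟶ Y.mid} (h : α = β) (hβ : β ∈ datum X Y) :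
    (homMk α (h ▸ hβ.1) (h ▸ hβ.2) : X ⟶ Y) = homMk β hβ.1 hβ.2 := by
  subst h; rfl

theorem homMk_zsmul {X Y : Adel A} {α : X.mid ⟶ Y.mid} (hα : α ∈ datum X Y) (n : ℤ) :
    n • homMk α hα.1 hα.2 =
      homMk (n • α) (zsmul_mem hα n).1 (zsmul_mem hα n).2 :=
  (QuotientAddGroup.mk_zsmul _ (⟨α, hα⟩ : datum X Y) n).symm

theorem isZero_of_isZero_mid {X : Adel A} (h : IsZero X.mid) : IsZero X := by
  rw [IsZero.iff_id_eq_zero]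
  exact (homMk_eq_zero_iff (id_mem_datum X).1 (id_mem_datum X).2).2 ⟨0, 0, h.eq_of_src _ _⟩

section KernelsCokernels

variable [HasBinaryBiproducts A]

/-- The kernel object of a morphism `{φ}`. -/
noncomputable abbrev kernelObj {X Y : Adel A} (φ : X.mid ⟶ Y.mid) : Adel A where
  ρ := biprod.map X.ρ (𝟙 Y.rel)
  γ := biprod.desc (biprod.lift X.γ φ) (biprod.lift 0 (-Y.ρ))

theorem fst_mem_datum {X Y : Adel A} (φ : X.mid ⟶ Y.mid) :
    (biprod.fst : X.mid ⊞ Y.rel ⟶ X.mid) ∈ datum (kernelObj φ) X :=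
  ⟨⟨biprod.fst, by simp⟩, ⟨biprod.fst, by apply biprod.hom_ext' <;> simp⟩⟩

/-- The inclusion of the kernel object. -/
noncomputable def kernelι {X Y : Adel A} (φ : X.mid ⟶ Y.mid) : kernelObj φ ⟶ X :=
  homMk (X := kernelObj φ) biprod.fst (fst_mem_datum φ).1 (fst_mem_datum φ).2

/-- The cokernel object of a morphism `{φ}`. -/
noncomputable abbrev cokernelObj {X Y : Adel A} (φ : X.mid ⟶ Y.mid) : Adel A where
  ρ := biprod.desc (biprod.lift Y.ρ 0) (biprod.lift φ (-X.γ))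
  γ := biprod.map Y.γ (𝟙 X.corel)

theorem inl_mem_datum {X Y : Adel A} (φ : X.mid ⟶ Y.mid) :
    (biprod.inl : Y.mid ⟶ Y.mid ⊞ X.corel) ∈ datum Y (cokernelObj φ) :=
  ⟨⟨biprod.inl, by apply biprod.hom_ext <;> simp⟩, ⟨biprod.inl, by simp⟩⟩

/-- The projection to the cokernel object. -/
noncomputable def cokernelπ {X Y : Adel A} (φ : X.mid ⟶ Y.mid) : Y ⟶ cokernelObj φ :=
  homMk (Y := cokernelObj φ) biprod.inl (inl_mem_datum φ).1 (inl_mem_datum φ).2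

/-- The summand `Y.rel` of the middle object is itself a relation, via the entry `𝟙 Y.rel`, so the
second component of a map into `kernelObj φ` never affects its class. -/
instance {X Y : Adel A} (φ : X.mid ⟶ Y.mid) : Mono (kernelι φ) := by
  refine Preadditive.mono_of_cancel_zero _ fun {W} h hh => ?_
  obtain ⟨θ, hω, hψ, rfl⟩ := exists_homMk h
  obtain ⟨σ₁, σ₂, e⟩ := (homMk_comp_homMk_eq_zero_iff ⟨hω, hψ⟩ (fst_mem_datum φ)).1 hh
  refine (homMk_eq_zero_iff _ _).2 ⟨biprod.lift σ₁ (θ ≫ biprod.snd), σ₂ ≫ biprod.inl, ?_⟩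
  apply biprod.hom_ext
  · simpa using e
  · simp

instance {X Y : Adel A} (φ : X.mid ⟶ Y.mid) : Epi (cokernelπ φ) := by
  refine Preadditive.epi_of_cancel_zero _ fun {W} h hh => ?_
  obtain ⟨θ, hω, hψ, rfl⟩ := exists_homMk h
  obtain ⟨σ₁, σ₂, e⟩ := (homMk_comp_homMk_eq_zero_iff (inl_mem_datum φ) ⟨hω, hψ⟩).1 hh
  refine (homMk_eq_zero_iff _ _).2 ⟨biprod.fst ≫ σ₁, biprod.desc σ₂ (biprod.inr ≫ θ), ?_⟩
  apply biprod.hom_ext'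
  · simpa using e
  · simp

variable {X Y : Adel A} {φ : X.mid ⟶ Y.mid} (hφ : φ ∈ datum X Y)

theorem kernelι_comp : kernelι φ ≫ homMk φ hφ.1 hφ.2 = 0 :=
  (homMk_comp_homMk_eq_zero_iff (fst_mem_datum φ) hφ).2 ⟨biprod.snd, biprod.snd, by
    apply biprod.hom_ext' <;> simp⟩

theorem comp_cokernelπ : homMk φ hφ.1 hφ.2 ≫ cokernelπ φ = 0 :=
  (homMk_comp_homMk_eq_zero_iff hφ (inl_mem_datum φ)).2 ⟨biprod.inr, biprod.inr, by
    apply biprod.hom_ext <;> simp⟩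

/-- A nullity witness for `τ ≫ φ` is what a lift needs: `σ₁` is its second component, and `σ₂`
completes its corelation witness. -/
theorem lift_mem_datum {W : Adel A} {τ : W.mid ⟶ X.mid} (hτ : τ ∈ datum W X)
    {σ₁ : W.mid ⟶ Y.rel} {σ₂ : W.corel ⟶ Y.mid} (e : τ ≫ φ = σ₁ ≫ Y.ρ + W.γ ≫ σ₂) :
    biprod.lift τ σ₁ ∈ datum W (kernelObj φ) := by
  obtain ⟨⟨ω, h⟩, ⟨ψ, k⟩⟩ := hτ
  refine ⟨⟨biprod.lift ω (W.ρ ≫ σ₁), ?_⟩, ⟨biprod.lift ψ σ₂, ?_⟩⟩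
  · apply biprod.hom_ext <;> simp [h]
  · apply biprod.hom_ext <;> simp [k, e]

theorem desc_mem_datum {W : Adel A} {τ : Y.mid ⟶ W.mid} (hτ : τ ∈ datum Y W)
    {σ₁ : X.mid ⟶ W.rel} {σ₂ : X.corel ⟶ W.mid} (e : φ ≫ τ = σ₁ ≫ W.ρ + X.γ ≫ σ₂) :
    biprod.desc τ σ₂ ∈ datum (cokernelObj φ) W := by
  obtain ⟨⟨ω, h⟩, ⟨ψ, k⟩⟩ := hτ
  refine ⟨⟨biprod.desc ω σ₁, ?_⟩, ⟨biprod.desc ψ (σ₂ ≫ W.γ), ?_⟩⟩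
  · apply biprod.hom_ext' <;> simp [h, e]
  · apply biprod.hom_ext' <;> simp [k]

theorem lift_comp_kernelι {W : Adel A} {τ : W.mid ⟶ X.mid} (hτ : τ ∈ datum W X)
    {σ₁ : W.mid ⟶ Y.rel} {σ₂ : W.corel ⟶ Y.mid} (e : τ ≫ φ = σ₁ ≫ Y.ρ + W.γ ≫ σ₂) :
    homMk (Y := kernelObj φ) (biprod.lift τ σ₁) (lift_mem_datum hτ e).1 (lift_mem_datum hτ e).2 ≫
      kernelι φ =
      homMk τ hτ.1 hτ.2 :=
  homMk_congr (biprod.lift_fst τ σ₁) hτ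

theorem cokernelπ_comp_desc {W : Adel A} {τ : Y.mid ⟶ W.mid} (hτ : τ ∈ datum Y W)
    {σ₁ : X.mid ⟶ W.rel} {σ₂ : X.corel ⟶ W.mid} (e : φ ≫ τ = σ₁ ≫ W.ρ + X.γ ≫ σ₂) :
    cokernelπ φ ≫ homMk (X := cokernelObj φ) (biprod.desc τ σ₂)
      (desc_mem_datum hτ e).1 (desc_mem_datum hτ e).2 =
      homMk τ hτ.1 hτ.2 :=
  homMk_congr (biprod.inl_desc τ σ₂) hτ

/-- `kernelι φ` is a kernel of `{φ}`. -/
noncomputable def isLimitKernelι : IsLimit (KernelFork.ofι (kernelι φ) (kernelι_comp hφ)) :=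
  KernelFork.IsLimit.ofι' _ _ fun {W} k hk => Classical.indefiniteDescription _ (by
    obtain ⟨τ, hω, hψ, rfl⟩ := exists_homMk k
    obtain ⟨σ₁, σ₂, e⟩ := (homMk_comp_homMk_eq_zero_iff ⟨hω, hψ⟩ hφ).1 hk
    exact ⟨_, lift_comp_kernelι ⟨hω, hψ⟩ e⟩)

/-- `cokernelπ φ` is a cokernel of `{φ}`. -/
noncomputable def isColimitCokernelπ :
    IsColimit (CokernelCofork.ofπ (cokernelπ φ) (comp_cokernelπ hφ)) :=
  CokernelCofork.IsColimit.ofπ' _ _ fun {W} k hk => Classical.indefiniteDescription _ (by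
    obtain ⟨τ, hω, hψ, rfl⟩ := exists_homMk k
    obtain ⟨σ₁, σ₂, e⟩ := (homMk_comp_homMk_eq_zero_iff hφ ⟨hω, hψ⟩).1 hk
    exact ⟨_, cokernelπ_comp_desc ⟨hω, hψ⟩ e⟩)

end KernelsCokernels

/-! ### A matrix criterion for exactness. -/

section Exactness

/-- Morphisms of `A` which witness that `{φ}` and `{χ}` form an exact pair. -/
structure ExactWitness {X Y Z : Adel A} (φ : X.mid ⟶ Y.mid) (χ : Y.mid ⟶ Z.mid) where
  s : Y.mid ⟶ Y.rel
  s' : Y.mid ⟶ X.mid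
  t : Y.corel ⟶ Y.mid
  t' : Z.mid ⟶ Y.mid
  u : Z.rel ⟶ Y.rel
  u' : Z.rel ⟶ X.mid
  v : Y.corel ⟶ X.corel
  v' : Z.mid ⟶ X.corel
  id_eq : 𝟙 Y.mid = s ≫ Y.ρ + s' ≫ φ + Y.γ ≫ t + χ ≫ t'
  comp_γ : s' ≫ X.γ = Y.γ ≫ v + χ ≫ v'
  ρ_comp : Z.ρ ≫ t' = u ≫ Y.ρ + u' ≫ φ
  u'_comp : u' ≫ X.γ = -(Z.ρ ≫ v')

variable [HasBinaryBiproducts A] {X Y Z : Adel A} {φ : X.mid ⟶ Y.mid} {χ : Y.mid ⟶ Z.mid}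
  (E : ExactWitness φ χ) (hφ : φ ∈ datum X Y) (hχ : χ ∈ datum Y Z)
  {σ₁ : X.mid ⟶ Z.rel} {σ₂ : X.corel ⟶ Z.mid}

-- The fields of `E` are the entries of the two matrices showing that `kernelι χ ≫ cokernelπ φ` is
-- null: `s, s', u, u'` form `σ₁`, while `t, v, t', v'` form `σ₂`. The four equations compare
-- components.
include E in
theorem ExactWitness.epi_lift (e : φ ≫ χ = σ₁ ≫ Z.ρ + X.γ ≫ σ₂) :
    Epi (homMk (Y := kernelObj χ) (biprod.lift φ σ₁) (lift_mem_datum hφ e).1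
      (lift_mem_datum hφ e).2) := by
  refine Preadditive.epi_of_cancel_zero _ fun {W} h hh => ?_
  obtain ⟨θ, ⟨ω, hω⟩, hψ, rfl⟩ := exists_homMk h
  obtain ⟨p, q, hpq⟩ := (homMk_comp_homMk_eq_zero_iff (lift_mem_datum hφ e) ⟨⟨ω, hω⟩, hψ⟩).1 hh
  refine (homMk_eq_zero_iff _ _).2 ?_
  obtain ⟨h₁, h₂, rfl⟩ : ∃ h₁ h₂, θ = biprod.desc h₁ h₂ :=
    ⟨biprod.inl ≫ θ, biprod.inr ≫ θ, by apply biprod.hom_ext' <;> simp⟩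
  have e₁ := biprod.inl ≫= hω
  have e₂ := biprod.inr ≫= hω
  simp only [biprod.inl_map_assoc, biprod.inr_map_assoc, biprod.inl_desc,
    biprod.inr_desc, Category.id_comp] at e₁ e₂
  have e₃ : φ ≫ h₁ = p ≫ W.ρ + X.γ ≫ q - σ₁ ≫ h₂ := by
    rw [← hpq, biprod.lift_desc]; abel
  have e₄ : h₁ = E.s ≫ Y.ρ ≫ h₁ + E.s' ≫ φ ≫ h₁ + Y.γ ≫ E.t ≫ h₁ + χ ≫ E.t' ≫ h₁ := by
    simpa using E.id_eq =≫ h₁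
  have e₅ := E.comp_γ =≫ q
  have e₆ := E.ρ_comp =≫ h₁
  have e₇ := E.u'_comp =≫ q
  simp only [Preadditive.add_comp, Preadditive.neg_comp, Category.assoc] at e₅ e₆ e₇
  -- Expand `h₁` by `E.id_eq` and substitute `e₁`, `e₂`, `e₃`, `e₅`: terms ending in `W.ρ` go into
  -- the first entry, terms starting with `Y.γ` or `χ` into the second. The extra `biprod.inr ≫ ω`
  -- in the `Z.rel` component produces `h₂`, and the other terms there cancel by `e₆` and `e₇`.
  refine ⟨biprod.desc (E.s ≫ biprod.inl ≫ ω + E.s' ≫ p - E.s' ≫ σ₁ ≫ biprod.inr ≫ ω)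
    (biprod.inr ≫ ω + E.u ≫ biprod.inl ≫ ω + E.u' ≫ p - E.u' ≫ σ₁ ≫ biprod.inr ≫ ω),
    biprod.desc (E.t ≫ h₁ + E.v ≫ q) (E.t' ≫ h₁ + E.v' ≫ q), ?_⟩
  apply biprod.hom_ext'
  · rw [e₃] at e₄
    simp only [Preadditive.comp_add, Preadditive.comp_sub, Preadditive.add_comp,
      Preadditive.sub_comp, Category.assoc, biprod.inl_desc, biprod.inl_desc_assoc,
      biprod.lift_desc, e₁, e₂, e₅] at e₄ ⊢
    refine e₄.trans ?_
    abel
  · rw [e₃] at e₆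
    simp only [Preadditive.comp_add, Preadditive.comp_sub, Preadditive.add_comp,
      Preadditive.sub_comp, Category.assoc, biprod.inr_desc, biprod.inr_desc_assoc,
      biprod.lift_desc, zero_comp, zero_add, Preadditive.neg_comp, e₁, e₂, e₆, e₇]
    abel

-- Dual to `epi_lift`; the same eight entries serve both sides.
include E in
theorem ExactWitness.mono_desc (e : φ ≫ χ = σ₁ ≫ Z.ρ + X.γ ≫ σ₂) :
    Mono (homMk (X := cokernelObj φ) (biprod.desc χ σ₂) (desc_mem_datum hχ e).1
      (desc_mem_datum hχ e).2) := by
  refine Preadditive.mono_of_cancel_zero _ fun {W} h hh => ?_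
  obtain ⟨θ, hω, ⟨ψ, hψ⟩, rfl⟩ := exists_homMk h
  obtain ⟨p, q, hpq⟩ := (homMk_comp_homMk_eq_zero_iff ⟨hω, ⟨ψ, hψ⟩⟩ (desc_mem_datum hχ e)).1 hh
  refine (homMk_eq_zero_iff _ _).2 ?_
  obtain ⟨h₁, h₂, rfl⟩ : ∃ h₁ h₂, θ = biprod.lift h₁ h₂ :=
    ⟨θ ≫ biprod.fst, θ ≫ biprod.snd, by apply biprod.hom_ext <;> simp⟩
  have e₁ := hψ.symm =≫ biprod.fst
  have e₂ := hψ.symm =≫ biprod.snd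
  simp only [biprod.map_fst, biprod.map_snd, biprod.lift_fst_assoc, Category.comp_id,
    biprod.lift_snd, Category.assoc] at e₁ e₂
  have e₃ : h₁ ≫ χ = p ≫ Z.ρ + W.γ ≫ q - h₂ ≫ σ₂ := by
    rw [← hpq, biprod.lift_desc]; abel
  have e₄ : h₁ = h₁ ≫ E.s ≫ Y.ρ + h₁ ≫ E.s' ≫ φ + (h₁ ≫ Y.γ) ≫ E.t + (h₁ ≫ χ) ≫ E.t' := by
    simpa using h₁ ≫= E.id_eq
  have e₅ := h₁ ≫= E.comp_γ
  rw [Preadditive.comp_add, ← Category.assoc h₁ Y.γ, ← Category.assoc h₁ χ] at e₅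
  refine ⟨biprod.lift (h₁ ≫ E.s + p ≫ E.u) (h₁ ≫ E.s' + p ≫ E.u'),
    biprod.lift (ψ ≫ biprod.fst ≫ E.t + q ≫ E.t' - ψ ≫ biprod.snd ≫ σ₂ ≫ E.t')
      (ψ ≫ biprod.snd + ψ ≫ biprod.fst ≫ E.v + q ≫ E.v' - ψ ≫ biprod.snd ≫ σ₂ ≫ E.v'), ?_⟩
  apply biprod.hom_ext
  · rw [e₁, e₃, e₂] at e₄
    simp only [Preadditive.comp_add, Preadditive.comp_sub, Preadditive.add_comp,
      Preadditive.sub_comp, Category.assoc, biprod.lift_fst, biprod.lift_desc,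
      E.ρ_comp] at e₄ ⊢
    refine e₄.trans ?_
    abel
  · rw [e₁, e₃, e₂] at e₅
    simp only [Preadditive.comp_add, Preadditive.comp_sub, Preadditive.add_comp,
      Preadditive.sub_comp, Category.assoc, biprod.lift_snd, biprod.lift_desc, e₂] at e₅ ⊢
    simp [e₅, E.u'_comp]
    abel

include E in
/-- A pair of morphisms with composite zero and an `ExactWitness` is exact. -/
theorem ExactWitness.exact {O : Adel A} (hO : IsZero O)
    (w : homMk φ hφ.1 hφ.2 ≫ homMk χ hχ.1 hχ.2 = 0) :
    (ShortComplex.mk _ _ w).Exact := by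
  obtain ⟨σ₁, σ₂, e⟩ := (homMk_comp_homMk_eq_zero_iff hφ hχ).1 w
  exact ShortComplex.exact_of_epi_of_mono _ hO _ _ (isLimitKernelι hχ) _
    (lift_comp_kernelι hφ e) (E.epi_lift hφ e) _ _ (isColimitCokernelπ hφ) _
    (cokernelπ_comp_desc hχ e) (E.mono_desc hχ e)

end Exactness
end Adel

/-! ### An integral representation and the morphisms between vertices. -/

namespace Snake

open SnakeVertex

/-- The representation of the snake quiver by `1 × 1` integral matrices in which the arrow `α` acts
as zero and the arrows `β` and `γ` as the identity. -/
def rep : SnakeVertex ⥤q SingleObj ℤ where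
  obj _ := SingleObj.star ℤ
  map
    | .α => (0 : ℤ)
    | .β => (1 : ℤ)
    | .γ => (1 : ℤ)

/-- The linear extension of `rep` to linear combinations of paths. -/
noncomputable def freeRep : Free ℤ (Paths SnakeVertex) ⥤ SingleObj ℤ :=
  Free.lift ℤ (Paths.lift rep)

instance : freeRep.Additive :=
  inferInstanceAs (Free.lift ℤ (Paths.lift rep)).Additive

theorem freeRep_map_embedding {x y : Paths SnakeVertex} (p : x ⟶ y) :
    freeRep.map ((Free.embedding ℤ (Paths SnakeVertex)).map p) = (Paths.lift rep).map p :=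
  (Free.lift_map_single _ _ _ _).trans (one_smul _ _)

/-- It suffices to treat generators of the ideal, and `αβγ` acts as zero because `α` does. -/
theorem freeRep_map_eq_zero {x y : Free ℤ (Paths SnakeVertex)} {f : x ⟶ y}
    (hf : f ∈ pathIdeal relation x y) : freeRep.map f = 0 := by
  refine (AddSubgroup.closure_le (K := (freeRep.mapAddHom : (x ⟶ y) →+ _).ker)).2 ?_ hf
  rintro _ ⟨_, _, p, _, q, ⟨⟩, rfl⟩
  change freeRep.map _ = 0
  rw [Functor.map_comp, Functor.map_comp, freeRep_map_embedding]
  have : (Paths.lift rep).map (arrow .α ≫ arrow .β ≫ arrow .γ) = 0 := by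
    rw [Functor.map_comp]
    exact (congrArg (· ≫ _) (Paths.lift_toPath rep SnakeArrow.α)).trans zero_comp
  rw [this, zero_comp, comp_zero]

/-- The representation of `C(Q, R)` induced by `rep`. -/
noncomputable def quotientRep : QuiverCat relation ⥤ SingleObj ℤ :=
  CategoryTheory.Quotient.lift _ freeRep fun _ _ f g h => by
    rw [← sub_eq_zero, ← Functor.map_sub]
    exact freeRep_map_eq_zero h

theorem quotientRep_ofPaths {x y : Paths SnakeVertex} (p : x ⟶ y) :
    quotientRep.map ((QuiverCat.ofPaths relation).map p) = (Paths.lift rep).map p :=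
  freeRep_map_embedding p

instance : quotientRep.Additive where
  map_add := by
    rintro x y ⟨f⟩ ⟨g⟩
    exact freeRep.map_add

instance : (CategoryTheory.Quotient.functor (pathRel relation)).Additive where
  map_add := rfl

/-- If `p` is the only path between two vertices, then every morphism between them is a multiple
of `p`. -/
theorem exists_eq_zsmul {x y : SnakeVertex} (p : Quiver.Path x y) (hp : ∀ q, q = p)
    (f : obj x ⟶ obj y) : ∃ n : ℤ, f = n • (Mat_.embedding (QuiverCat relation)).map
      ((QuiverCat.ofPaths relation).map (X := (Paths.of _).obj x) (Y := (Paths.of _).obj y) p) := by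
  -- Both functors are full, so `f` lifts to a combination of paths; `n` is its coefficient at `p`.
  obtain ⟨f, rfl⟩ := (Mat_.embedding (QuiverCat relation)).map_surjective f
  obtain ⟨f, rfl⟩ := (CategoryTheory.Quotient.functor (pathRel relation)).map_surjective f
  obtain ⟨n, hn⟩ : ∃ n : ℤ, f = n • (Free.embedding ℤ (Paths SnakeVertex)).map p := by
    refine ⟨(show (Quiver.Path x y) →₀ ℤ from f) p, Finsupp.ext fun q => ?_⟩
    obtain rfl := hp q
    change (show (Quiver.Path x y) →₀ ℤ from f) q = (_ : ℤ) • (Finsupp.single q (1 : ℤ)) q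
    rw [Finsupp.single_eq_same, smul_eq_mul, mul_one]
  refine ⟨n, ?_⟩
  rw [← Functor.map_zsmul]
  refine congrArg (Mat_.embedding (QuiverCat relation)).map ?_
  rw [hn]
  exact Functor.map_zsmul _

theorem eq_zero_of_isEmpty {x y : SnakeVertex} (h : IsEmpty (Quiver.Path x y))
    (f : obj x ⟶ obj y) : f = 0 := by
  obtain ⟨f, rfl⟩ := (Mat_.embedding (QuiverCat relation)).map_surjective f
  obtain ⟨f, rfl⟩ := (CategoryTheory.Quotient.functor (pathRel relation)).map_surjective f
  have hf : f = 0 := Finsupp.ext fun q => h.elim q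
  rw [hf]
  exact (congrArg (Mat_.embedding (QuiverCat relation)).map
    ((CategoryTheory.Quotient.functor (pathRel relation)).map_zero _ _)).trans
      (Functor.map_zero _ _ _)

/-- The position of a vertex along the quiver. -/
def rank : SnakeVertex → ℕ
  | a => 0
  | b => 1
  | c => 2
  | d => 3

theorem rank_le_of_arrow {x y : SnakeVertex} (e : SnakeArrow x y) : rank x ≤ rank y := by
  cases e <;> decide

theorem rank_le_of_path {x y : SnakeVertex} (p : Quiver.Path x y) : rank x ≤ rank y := by
  induction p with
  | nil => exact le_rfl
  | cons _ e ih => exact ih.trans (rank_le_of_arrow e)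

/-- There are no morphisms against the direction of the arrows. -/
theorem eq_zero_of_rank_lt {x y : SnakeVertex} (h : rank y < rank x) (f : obj x ⟶ obj y) : f = 0 :=
  eq_zero_of_isEmpty ⟨fun p => (rank_le_of_path p).not_gt h⟩ f

theorem path_b_c_eq (p : Quiver.Path b c) : p = Quiver.Hom.toPath SnakeArrow.β := by
  cases p with
  | cons p e =>
    change SnakeArrow _ _ at e
    cases e
    cases p with
    | nil => rfl
    | cons p e =>
      change SnakeArrow _ _ at e
      cases e
      exact absurd (rank_le_of_path p) (by decide)

theorem exists_eq_zsmul_β (f : obj b ⟶ obj c) : ∃ n : ℤ, f = n • β :=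
  exists_eq_zsmul _ path_b_c_eq f

/-- The representation `quotientRep`, evaluated on morphisms between vertices. -/
noncomputable def coeff {x y : SnakeVertex} (f : obj x ⟶ obj y) : ℤ :=
  quotientRep.map (f PUnit.unit PUnit.unit)

/-- The factors are swapped because composition in `SingleObj ℤ` is multiplication in reverse order.
-/
theorem coeff_comp {x y z : SnakeVertex} (f : obj x ⟶ obj y) (g : obj y ⟶ obj z) :
    coeff (f ≫ g) = coeff g * coeff f := by
  obtain ⟨f, rfl⟩ := (Mat_.embedding (QuiverCat relation)).map_surjective f
  obtain ⟨g, rfl⟩ := (Mat_.embedding (QuiverCat relation)).map_surjective g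
  rw [← Functor.map_comp]
  exact quotientRep.map_comp f g

theorem coeff_zsmul {x y : SnakeVertex} (n : ℤ) (f : obj x ⟶ obj y) :
    coeff (n • f) = n * coeff f :=
  (map_zsmul (AddMonoidHom.mk' coeff fun f g =>
    quotientRep.map_add (f := f PUnit.unit PUnit.unit) (g := g PUnit.unit PUnit.unit)) n f).trans
      (smul_eq_mul n (coeff f))

theorem coeff_β : coeff β = 1 :=
  (quotientRep_ofPaths (arrow .β)).trans (Paths.lift_toPath rep SnakeArrow.β)

/-! ### The group `Hom(K, C)` and the necessity of `n = ±1`. -/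

open scoped ZeroObject

instance : HasBinaryBiproducts Cat :=
  hasBinaryBiproducts_of_finite_biproducts _

theorem α_mem_datum : α ∈ Adel.datum kerδ kerβ :=
  ⟨⟨0, zero_comp.trans zero_comp.symm⟩, ⟨𝟙 _, Category.comp_id (α ≫ β)⟩⟩

theorem id_b_mem_datum : 𝟙 (obj b) ∈ Adel.datum kerβ kerε :=
  ⟨⟨0, zero_comp.trans zero_comp.symm⟩, ⟨γ, (Category.id_comp (β ≫ γ)).symm⟩⟩

theorem β_mem_datum : β ∈ Adel.datum kerε cokerδ :=
  ⟨⟨𝟙 _, Category.id_comp (α ≫ β)⟩, ⟨𝟙 _, Category.comp_id (β ≫ γ)⟩⟩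

theorem id_c_mem_datum : 𝟙 (obj c) ∈ Adel.datum cokerδ cokerβ :=
  ⟨⟨α, (Category.comp_id (α ≫ β)).symm⟩, ⟨0, comp_zero.trans comp_zero.symm⟩⟩

theorem γ_mem_datum : γ ∈ Adel.datum cokerβ cokerε :=
  ⟨⟨𝟙 _, Category.id_comp (β ≫ γ)⟩, ⟨0, comp_zero.trans comp_zero.symm⟩⟩

theorem zsmul_connecting (n : ℤ) :
    n • connecting = Adel.homMk (n • β) (zsmul_mem β_mem_datum n).1 (zsmul_mem β_mem_datum n).2 :=
  Adel.homMk_zsmul β_mem_datum n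

theorem exists_eq_zsmul_connecting (bd : kerε ⟶ cokerδ) : ∃ n : ℤ, bd = n • connecting := by
  obtain ⟨φ, hω, hψ, rfl⟩ := Adel.exists_homMk bd
  obtain ⟨n, hn⟩ := exists_eq_zsmul_β φ
  exact ⟨n, (Adel.homMk_congr hn (zsmul_mem β_mem_datum n)).trans (zsmul_connecting n).symm⟩

theorem eq_zero_of_zsmul_connecting {n : ℤ} (h : n • connecting = 0) : n = 0 := by
  rw [zsmul_connecting] at h
  obtain ⟨σ₁, σ₂, e⟩ := (Adel.homMk_eq_zero_iff _ _).1 h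
  have h₁ : σ₁ = (0 : obj b ⟶ obj a) := eq_zero_of_rank_lt (by decide) σ₁
  have h₂ : σ₂ = (0 : obj d ⟶ obj c) := eq_zero_of_rank_lt (by decide) σ₂
  rw [h₁, h₂] at e
  have e' : n • β = (0 : ℤ) • β := by
    rw [zero_smul]
    exact e.trans ((congrArg₂ (· + ·) zero_comp comp_zero).trans (add_zero _))
  simpa only [coeff_zsmul, coeff_β, mul_one] using congrArg coeff e'

/-- `Hom(K, C)` is infinite cyclic, generated by `{β}`. -/
noncomputable def homEquiv : (kerε ⟶ cokerδ) ≃+ ℤ :=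
  (AddEquiv.ofBijective (zmultiplesHom _ connecting)
    ⟨(injective_iff_map_eq_zero _).2 fun _ h => eq_zero_of_zsmul_connecting h,
      fun bd => (exists_eq_zsmul_connecting bd).imp fun _ h => h.symm⟩).symm

theorem homEquiv_connecting : homEquiv connecting = 1 :=
  (AddEquiv.symm_apply_eq _).2 (one_zsmul connecting).symm

theorem f₂_comp_connecting : f₂ ≫ connecting = 0 :=
  (Adel.homMk_comp_homMk_eq_zero_iff id_b_mem_datum β_mem_datum).2 ⟨0, 𝟙 (obj c),
    (Category.id_comp β).trans ((Category.comp_id β).symm.trans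
      ((congrArg (· + _) zero_comp).trans (zero_add _)).symm)⟩

/-- If the snake sequence with `n • {β}` in the middle is exact at `K`, then `n` is a unit. -/
theorem isUnit_of_exact {n : ℤ} (w : f₂ ≫ (n • connecting) = 0)
    (h : (ShortComplex.mk f₂ (n • connecting) w).Exact) : IsUnit n := by
  -- `T` is the part of `b` annihilated by `βγ` and `n • β`: the first entry gives a map to `K`, the
  -- second kills its composite with `n • {β}`.
  let T : Adel Cat := ⟨(0 : (0 : Cat) ⟶ obj b), biprod.lift (β ≫ γ) (n • β)⟩
  have ht : 𝟙 (obj b) ∈ Adel.datum T kerε :=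
    ⟨⟨0, zero_comp.trans zero_comp.symm⟩,
      ⟨biprod.fst, (biprod.lift_fst _ _).trans (Category.id_comp (β ≫ γ)).symm⟩⟩
  have h₁ : Adel.homMk (X := T) (Y := kerε) (𝟙 (obj b)) ht.1 ht.2 ≫ (n • connecting) = 0 := by
    rw [zsmul_connecting]
    refine (Adel.homMk_comp_homMk_eq_zero_iff ht (zsmul_mem β_mem_datum n)).2
      ⟨0, biprod.snd, ?_⟩
    exact (Category.id_comp (n • β)).trans ((biprod.lift_snd (β ≫ γ) (n • β)).symm.trans
      ((congrArg (· + _) zero_comp).trans (zero_add _)).symm)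
  obtain ⟨σ₁, σ₂, e⟩ : ∃ (σ₁ : obj b ⟶ obj a) (σ₂ : obj d ⊞ obj c ⟶ obj c),
      𝟙 (obj b) ≫ β = σ₁ ≫ α ≫ β + biprod.lift (β ≫ γ) (n • β) ≫ σ₂ :=
    (Adel.homMk_comp_homMk_eq_zero_iff ht β_mem_datum).1 (h.comp_eq_zero h₁ f₂_comp_connecting)
  -- Maps `b ⟶ a` and `d ⟶ c` vanish, leaving `β = (n • β) ≫ m` with `m : c ⟶ c`; applying `coeff`
  -- gives `coeff m * n = 1`.
  rw [Category.id_comp, eq_zero_of_rank_lt (by decide) σ₁, zero_comp, zero_add,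
    biprod.lift_eq, Preadditive.add_comp, Category.assoc, Category.assoc,
    eq_zero_of_rank_lt (by decide) (biprod.inl ≫ σ₂), comp_zero, comp_zero, zero_add,
    Category.assoc] at e
  have e' := congrArg coeff e
  rw [coeff_comp, coeff_zsmul, coeff_β, mul_one] at e'
  exact IsUnit.of_mul_eq_one_right _ e'.symm

/-! ### Exactness of the snake sequence when `n * n = 1`. -/

theorem isZero_adel_zero : IsZero (⟨𝟙 0, 𝟙 0⟩ : Adel Cat) :=
  Adel.isZero_of_isZero_mid (isZero_zero Cat)

theorem f₁_comp_f₂ : f₁ ≫ f₂ = 0 :=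
  (Adel.homMk_comp_homMk_eq_zero_iff α_mem_datum id_b_mem_datum).2 ⟨𝟙 (obj a), 0,
    (Category.comp_id α).trans ((Category.id_comp α).symm.trans
      ((congrArg (_ + ·) comp_zero).trans (add_zero _)).symm)⟩

theorem f₂_comp_zsmul_connecting (n : ℤ) : f₂ ≫ (n • connecting) = 0 := by
  rw [Preadditive.comp_zsmul, f₂_comp_connecting, smul_zero]

theorem zsmul_connecting_comp_f₄ (n : ℤ) : (n • connecting) ≫ f₄ = 0 := by
  have h : connecting ≫ f₄ = 0 :=
    (Adel.homMk_comp_homMk_eq_zero_iff β_mem_datum id_c_mem_datum).2 ⟨𝟙 (obj b), 0,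
      (Category.comp_id β).trans ((Category.id_comp β).symm.trans
        ((congrArg (_ + ·) comp_zero).trans (add_zero _)).symm)⟩
  rw [Preadditive.zsmul_comp, h, smul_zero]

theorem f₄_comp_f₅ : f₄ ≫ f₅ = 0 :=
  (Adel.homMk_comp_homMk_eq_zero_iff id_c_mem_datum γ_mem_datum).2 ⟨0, 𝟙 (obj d),
    (Category.id_comp γ).trans ((Category.comp_id γ).symm.trans
      ((congrArg (· + _) zero_comp).trans (zero_add _)).symm)⟩

theorem exact_kerβ : (ShortComplex.mk f₁ f₂ f₁_comp_f₂).Exact := by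
  let E : Adel.ExactWitness (X := kerδ) (Y := kerβ) (Z := kerε) α (𝟙 (obj b)) :=
    { s := (0 : obj b ⟶ (0 : Cat))
      s' := (0 : obj b ⟶ obj a)
      t := (0 : obj c ⟶ obj b)
      t' := 𝟙 (obj b)
      u := (0 : obj a ⟶ (0 : Cat))
      u' := 𝟙 (obj a)
      v := 𝟙 (obj c)
      v' := -β
      id_eq := by
        -- The equation is restated on the vertices themselves, with the fields of `kerδ`, `kerβ`,
        -- `kerε` unfolded, so that rewriting applies.
        have h : 𝟙 (obj b) = (0 : obj b ⟶ (0 : Cat)) ≫ (0 : (0 : Cat) ⟶ obj b) +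
            (0 : obj b ⟶ obj a) ≫ α + β ≫ (0 : obj c ⟶ obj b) + 𝟙 (obj b) ≫ 𝟙 (obj b) := by
          simp only [zero_comp, comp_zero, zero_add, Category.comp_id]
        exact h
      comp_γ := by
        have h : (0 : obj b ⟶ obj a) ≫ α ≫ β = β ≫ 𝟙 (obj c) + 𝟙 (obj b) ≫ (-β) := by
          simp only [zero_comp, Category.comp_id, Category.id_comp, add_neg_cancel]
        exact h
      ρ_comp := by
        have h : α ≫ 𝟙 (obj b) = (0 : obj a ⟶ (0 : Cat)) ≫ (0 : (0 : Cat) ⟶ obj b) +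
            𝟙 (obj a) ≫ α := by
          simp only [zero_comp, zero_add, Category.comp_id, Category.id_comp]
        exact h
      u'_comp := by
        have h : 𝟙 (obj a) ≫ α ≫ β = -(α ≫ (-β)) := by
          rw [Category.id_comp, Preadditive.comp_neg, neg_neg]
        exact h }
  exact E.exact α_mem_datum id_b_mem_datum isZero_adel_zero f₁_comp_f₂

/-- Since `φ` is the identity, `s' = 𝟙` suffices for `id_eq`. Then `comp_γ` asks for `β = (n • β) ≫
v'`, the only place where `n * n = 1` enters. -/
theorem exact_kerε {n : ℤ} (hn : n * n = 1) :
    (ShortComplex.mk f₂ (n • connecting) (f₂_comp_zsmul_connecting n)).Exact := by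
  let E : Adel.ExactWitness (X := kerβ) (Y := kerε) (Z := cokerδ) (𝟙 (obj b)) (n • β) :=
    { s := (0 : obj b ⟶ obj a)
      s' := 𝟙 (obj b)
      t := (0 : obj d ⟶ obj b)
      t' := (0 : obj c ⟶ obj b)
      u := n • 𝟙 (obj a)
      u' := -(n • α)
      v := (0 : obj d ⟶ obj c)
      v' := n • 𝟙 (obj c)
      id_eq := by
        have h : 𝟙 (obj b) = (0 : obj b ⟶ obj a) ≫ α + 𝟙 (obj b) ≫ 𝟙 (obj b) +
            (β ≫ γ) ≫ (0 : obj d ⟶ obj b) + (n • β) ≫ (0 : obj c ⟶ obj b) := by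
          simp only [zero_comp, comp_zero, zero_add, add_zero, Category.comp_id]
        exact h
      comp_γ := by
        have h : 𝟙 (obj b) ≫ β = (β ≫ γ) ≫ (0 : obj d ⟶ obj c) + (n • β) ≫ (n • 𝟙 (obj c)) := by
          rw [Category.id_comp, comp_zero, zero_add, Preadditive.comp_zsmul, Category.comp_id,
            smul_smul, hn, one_smul]
        exact h
      ρ_comp := by
        have h : (α ≫ β) ≫ (0 : obj c ⟶ obj b) = (n • 𝟙 (obj a)) ≫ α + (-(n • α)) ≫ 𝟙 (obj b) := by
          rw [comp_zero, Preadditive.zsmul_comp, Category.id_comp, Category.comp_id,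
            add_neg_cancel]
        exact h
      u'_comp := by
        have h : (-(n • α)) ≫ β = -((α ≫ β) ≫ (n • 𝟙 (obj c))) := by
          rw [Preadditive.neg_comp, Preadditive.zsmul_comp, Preadditive.comp_zsmul,
            Category.comp_id]
        exact h }
  convert! E.exact id_b_mem_datum (zsmul_mem β_mem_datum n) isZero_adel_zero
    (by rw [← zsmul_connecting]; exact f₂_comp_zsmul_connecting n) using 2

/-- Here `χ` is the identity and `t' = 𝟙`; dually, `ρ_comp` asks for `β = u' ≫ (n • β)`. -/
theorem exact_cokerδ {n : ℤ} (hn : n * n = 1) :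
    (ShortComplex.mk (n • connecting) f₄ (zsmul_connecting_comp_f₄ n)).Exact := by
  let E : Adel.ExactWitness (X := kerε) (Y := cokerδ) (Z := cokerβ) (n • β) (𝟙 (obj c)) :=
    { s := (0 : obj c ⟶ obj a)
      s' := (0 : obj c ⟶ obj b)
      t := (0 : obj d ⟶ obj c)
      t' := 𝟙 (obj c)
      u := (0 : obj b ⟶ obj a)
      u' := n • 𝟙 (obj b)
      v := n • 𝟙 (obj d)
      v' := -(n • γ)
      id_eq := by
        have h : 𝟙 (obj c) = (0 : obj c ⟶ obj a) ≫ α ≫ β + (0 : obj c ⟶ obj b) ≫ (n • β) +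
            γ ≫ (0 : obj d ⟶ obj c) + 𝟙 (obj c) ≫ 𝟙 (obj c) := by
          simp only [zero_comp, comp_zero, zero_add, Category.comp_id]
        exact h
      comp_γ := by
        have h : (0 : obj c ⟶ obj b) ≫ β ≫ γ = γ ≫ (n • 𝟙 (obj d)) + 𝟙 (obj c) ≫ (-(n • γ)) := by
          rw [zero_comp, Preadditive.comp_zsmul, Category.comp_id, Category.id_comp,
            add_neg_cancel]
        exact h
      ρ_comp := by
        have h : β ≫ 𝟙 (obj c) = (0 : obj b ⟶ obj a) ≫ α ≫ β + (n • 𝟙 (obj b)) ≫ (n • β) := by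
          rw [zero_comp, zero_add, Preadditive.zsmul_comp, Category.id_comp, Category.comp_id,
            smul_smul, hn, one_smul]
        exact h
      u'_comp := by
        have h : (n • 𝟙 (obj b)) ≫ β ≫ γ = -(β ≫ (-(n • γ))) := by
          rw [Preadditive.zsmul_comp, Category.id_comp, Preadditive.comp_neg, neg_neg,
            Preadditive.comp_zsmul]
        exact h }
  convert! E.exact (zsmul_mem β_mem_datum n) id_c_mem_datum isZero_adel_zero
    (by rw [← zsmul_connecting]; exact zsmul_connecting_comp_f₄ n) using 2

theorem exact_cokerβ : (ShortComplex.mk f₄ f₅ f₄_comp_f₅).Exact := by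
  let E : Adel.ExactWitness (X := cokerδ) (Y := cokerβ) (Z := cokerε) (𝟙 (obj c)) γ :=
    { s := (0 : obj c ⟶ obj b)
      s' := 𝟙 (obj c)
      t := (0 : (0 : Cat) ⟶ obj c)
      t' := (0 : obj d ⟶ obj c)
      u := 𝟙 (obj b)
      u' := -β
      v := (0 : (0 : Cat) ⟶ obj d)
      v' := 𝟙 (obj d)
      id_eq := by
        have h : 𝟙 (obj c) = (0 : obj c ⟶ obj b) ≫ β + 𝟙 (obj c) ≫ 𝟙 (obj c) +
            (0 : obj c ⟶ (0 : Cat)) ≫ (0 : (0 : Cat) ⟶ obj c) + γ ≫ (0 : obj d ⟶ obj c) := by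
          simp only [zero_comp, comp_zero, zero_add, add_zero, Category.comp_id]
        exact h
      comp_γ := by
        have h : 𝟙 (obj c) ≫ γ = (0 : obj c ⟶ (0 : Cat)) ≫ (0 : (0 : Cat) ⟶ obj d) +
            γ ≫ 𝟙 (obj d) := by
          rw [zero_comp, zero_add, Category.id_comp, Category.comp_id]
        exact h
      ρ_comp := by
        have h : (β ≫ γ) ≫ (0 : obj d ⟶ obj c) = 𝟙 (obj b) ≫ β + (-β) ≫ 𝟙 (obj c) := by
          rw [comp_zero, Category.id_comp, Category.comp_id, add_neg_cancel]
        exact h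
      u'_comp := by
        have h : (-β) ≫ γ = -((β ≫ γ) ≫ 𝟙 (obj d)) := by
          rw [Category.comp_id, Preadditive.neg_comp]
        exact h }
  exact E.exact id_c_mem_datum γ_mem_datum isZero_adel_zero f₄_comp_f₅

theorem sequence_exact {n : ℤ} (hn : n * n = 1) : (sequence (n • connecting)).Exact where
  zero
    | 0, _ => f₁_comp_f₂
    | 1, _ => f₂_comp_zsmul_connecting n
    | 2, _ => zsmul_connecting_comp_f₄ n
    | 3, _ => f₄_comp_f₅
    | _ + 4, h => absurd h (by omega)
  exact
    | 0, _ => exact_kerβ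
    | 1, _ => exact_kerε hn
    | 2, _ => exact_cokerδ hn
    | 3, _ => exact_cokerβ
    | _ + 4, h => absurd h (by omega)

end Snake

theorem mainTheorem4 :
    (∃ e : (Snake.kerε ⟶ Snake.cokerδ) ≃+ ℤ, e Snake.connecting = 1) ∧
    (∀ bd : Snake.kerε ⟶ Snake.cokerδ,
      (Snake.sequence bd).Exact ↔ bd = Snake.connecting ∨ bd = -Snake.connecting) := by
  refine ⟨⟨Snake.homEquiv, Snake.homEquiv_connecting⟩, fun bd => ⟨fun h => ?_, ?_⟩⟩
  · obtain ⟨n, rfl⟩ := Snake.exists_eq_zsmul_connecting bd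
    -- Index `1` is exactness at `K`, the only one of the four conditions needed here.
    rcases Int.isUnit_iff.1 (Snake.isUnit_of_exact (Snake.f₂_comp_zsmul_connecting n)
      (h.exact 1)) with rfl | rfl
    · exact Or.inl (one_zsmul _)
    · exact Or.inr (neg_one_zsmul _)
  · rintro (rfl | rfl)
    · simpa only [one_zsmul] using Snake.sequence_exact (n := 1) (by norm_num)
    · simpa only [neg_one_zsmul] using Snake.sequence_exact (n := -1) (by norm_num)
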